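/- **Model.** There are $N$ D2D links and $M$ bit rates $\mathsf R_1,\dots,\mathsf R_M\ge 0$ with SNR thresholds $\mathsf S_1,\dots,\mathsf S_M>0$; $\mathsf R_{\min}$ and $\mathsf R_{\max}$ denote the smallest and the largest rate. Let $N_o>0$ be the noise power, $L_n>0$ the path-loss term of link $n$, $P_{\max}>0$ the maximal power and $R_{th}\ge 0$ the throughput threshold. With fading coefficient $h_n\in\mathbb C$, link $n$ achieves the rate $\mathsf R_m$ with the power $P_{n,m}=\min\{\mathsf S_mN_o/(|h_n|^2L_n),\,P_{\max}\}$ (which is $P_{\max}$ if $h_n=0$). The vectors $H(t)=(h_1(t),\dots,h_N(t))$, $t=1,2,\dots$, are i.i.d. over the slots with an arbitrary joint law (for example Rayleigh fading). Formally there is a filtration $(\mathcal F_t)_{t\ge1}$ such that $H(t)$ is $\mathcal F_t$-measurable, $H(t+1)$ is independent of $\mathcal F_t$, and all $H(t)$ have the same law. A (scheduling) *policy* $\Gamma$ selects in each slot $t$, in an $\mathcal F_t$-measurable way, exactly one link $n$ and one rate index $m$. For the selected link $R_n(t)=\mathsf R_m$ and $P_n(t)=P_{n,m}(t)$; for all the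 other links $R_n(t)=P_n(t)=0$. Put $$\bar P(\Gamma)=\limsup_{T\to\infty}\frac1T\sum_{t=1}^T\sum_{n=1}^N\mathbb E[P_n(t)],\qquad \bar R_n(\Gamma)=\liminf_{T\to\infty}\frac1T\sum_{t=1}^T\mathbb E[R_n(t)].$$ A policy is *feasible* if $\bar R_n(\Gamma)\ge R_{th}$ for all $n$. The ideal optimum $P^*_{id}$ is the infimum of $\bar P(\Gamma)$ over all feasible policies (these know the instantaneous CSI of all links); assume that a feasible policy exists. The virtual queues are $Q_n(t+1)=[Q_n(t)-R_n(t)]^++R_{th}$, with deterministic initial values $Q_n(1)\ge 0$. **Distributed channel-indexing scheduling.** Let $V>0$. In slot $t$ each link computes $v_n(t)=\min_m\big(VP_{n,m}(t)-Q_n(t)\mathsf R_m\big)$. The interval from $v_{\min}(t)=-tR_{th}\mathsf R_{\max}$ to $v_{\max}=VP_{\max}-R_{th}\mathsf R_{\min}$ carries the grid $a_j=v_{\min}(t)+(j-1)\frac{v_{\max}-v_{\min}(t)}{K-1}$, $1\le j\le K$, where the number $K=K(t)$ of available resource elements is arbitrary and may depend on the slot and on the realization (if $K=1$ the only grid point is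 $v_{\min}(t)$). Link $n$ sends its CSI indicator on the resource element $\tilde k_n(t)$, the largest $j$ with $a_j<v_n(t)$ (and $1$ if there is none). The scheduled link is the one with the lowest $\tilde k_n(t)$ among the links that share their resource element with no other link, and it uses a rate index that attains the minimum in $v_n(t)$. A policy that almost surely acts in this way in every slot is denoted $\Gamma^{dist}$. *No collision* means that almost surely, in every slot, the indices $\tilde k_1(t),\dots,\tilde k_N(t)$ are pairwise distinct. **Statement.** Put $C=\frac12\big(NR_{th}^2+\mathsf R_{\max}^2\big)$, which does not depend on $V$. If no collision occurs under $\Gamma^{dist}$, then $\Gamma^{dist}$ is feasible and $$P^*_{id}\;\le\;\limsup_{T\to\infty}\frac1T\sum_{t=1}^T\sum_{n=1}^N\mathbb E\big[P_n(\Gamma^{dist}(t))\big]\;\le\;P^*_{id}+\frac CV .$$ Moreover, whenever $R_{th}$ is interior to the achievable region, that is, for every $\varepsilon>0$ and every policy $\Gamma$ with $\bar R_n(\Gamma)\ge R_{th}+\varepsilon$ for all $n$, all the virtual queues under $\Gamma^{dist}$ are strongly stable, i.e. $\limsup_T\frac1T\sum_{t=1}^T\mathbb E[Q_n(t)]<\infty$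 for each $n$, and $$\limsup_{T\to\infty}\frac1T\sum_{t=1}^{T}\sum_{n=1}^N\mathbb E[Q_n(t)]\;\le\;\frac{C+V\,\bar P(\Gamma)}{\varepsilon},$$ which is $O(V)$, since $\varepsilon$ and $\Gamma$ do not depend on $V$. -/

import Mathlib

open MeasureTheory ProbabilityTheory Filter
open scoped ENNReal

noncomputable section

namespace D2D

/-- Parameters of an overlay D2D network with `N` links and `M` bit rates: the bit rates `R_m`, the
SNR thresholds `S_m`, the noise power, the path-loss terms `L_n`, the maximal transmission power and
the throughput threshold `R_th`. -/
structure Network (N M : ℕ) where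
  rate : Fin M → ℝ
  snr : Fin M → ℝ
  noise : ℝ
  pathLoss : Fin N → ℝ
  Pmax : ℝ
  Rth : ℝ
  rate_nonneg : ∀ m, 0 ≤ rate m
  snr_pos : ∀ m, 0 < snr m
  noise_pos : 0 < noise
  pathLoss_pos : ∀ n, 0 < pathLoss n
  Pmax_pos : 0 < Pmax
  Rth_nonneg : 0 ≤ Rth

variable {N M : ℕ}

/-- The largest bit rate (`R_M` when the rates are listed in increasing order). -/
def Network.maxRate (S : Network N M) : ℝ := ⨆ m, S.rate m

/-- The smallest bit rate (`R_1` when the rates are listed in increasing order). -/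
def Network.minRate (S : Network N M) : ℝ := ⨅ m, S.rate m

/-- The power `P_{n,m} = min {S_m N_o / (|h|² L_n), P_max}` with which link `n` achieves the bit rate
`R_m` when its fading coefficient is `h`; for `h = 0` the first term is infinite. -/
def Network.power (S : Network N M) (n : Fin N) (m : Fin M) (h : ℂ) : ℝ :=
  open Classical in
  if h = 0 then S.Pmax else min (S.snr m * S.noise / (‖h‖ ^ 2 * S.pathLoss n)) S.Pmax

/-- The constant `C = (N R_th² + R_M²) / 2`. It bounds `∑_i (R_th² + R_i(t)²) / 2`, because one link
is served per slot. -/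
def Network.C (S : Network N M) : ℝ := (N * S.Rth ^ 2 + S.maxRate ^ 2) / 2

/-! ### Channels, scheduling policies, virtual queues

Time is indexed by `t : ℕ`, where the index `t` stands for the slot number `t + 1` (slots are
numbered `1, 2, 3, …`). -/

section Dynamics

variable {Ω : Type*} {mΩ : MeasurableSpace Ω}

/-- The vectors `H t = (h_1, …, h_N)` of fading coefficients are independent and identically
distributed over the slots, relative to the information `ℱ`: `H t` is known in slot `t`, and
`H (t + 1)` is independent of everything known in slot `t`. The common law is arbitrary; Rayleigh
fading is the case in which each coordinate is standard complex Gaussian. -/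
structure IsChannel (μ : Measure Ω) (ℱ : Filtration ℕ mΩ) (H : ℕ → Ω → Fin N → ℂ) : Prop where
  adapted : ∀ t, Measurable[ℱ t] (H t)
  identDistrib : ∀ t, IdentDistrib (H t) (H 0) μ μ
  indep : ∀ t, Indep (MeasurableSpace.comap (H (t + 1)) inferInstance) (ℱ t) μ

/-- A scheduling policy selects in each slot one link and the bit rate of this link, on the basis of
everything known in this slot: in particular the current and past channel states of all links. -/
def IsPolicy (ℱ : Filtration ℕ mΩ) (Γ : ℕ → Ω → Fin N × Fin M) : Prop :=
  ∀ t, Measurable[ℱ t] (Γ t)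

/-- The service rate `R_n(t)`: the chosen bit rate if link `n` is scheduled, and `0` otherwise. -/
def Network.service (S : Network N M) (Γ : ℕ → Ω → Fin N × Fin M) (t : ℕ) (n : Fin N) (ω : Ω) : ℝ :=
  if (Γ t ω).1 = n then S.rate (Γ t ω).2 else 0

/-- The transmission power `P_n(t)`: `P_{n,m}` if link `n` is scheduled with bit rate `R_m`, and `0`
otherwise. -/
def Network.txPower (S : Network N M) (H : ℕ → Ω → Fin N → ℂ) (Γ : ℕ → Ω → Fin N × Fin M)
    (t : ℕ) (n : Fin N) (ω : Ω) : ℝ :=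
  if (Γ t ω).1 = n then S.power n (Γ t ω).2 (H t ω n) else 0

/-- The virtual queues: `Q_n(t+1) = [Q_n(t) - R_n(t)]⁺ + R_th`, with initial backlogs `q₀`. -/
def Network.queue (S : Network N M) (q₀ : Fin N → ℝ) (Γ : ℕ → Ω → Fin N × Fin M) :
    ℕ → Fin N → Ω → ℝ
  | 0, n, _ => q₀ n
  | t + 1, n, ω => max (S.queue q₀ Γ t n ω - S.service Γ t n ω) 0 + S.Rth

/-- The time average of the total power, `limsup_T (1/T) ∑_{t ≤ T} ∑_n E[P_n(t)]`. -/
def Network.avgPower (S : Network N M) (μ : Measure Ω) (H : ℕ → Ω → Fin N → ℂ)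
    (Γ : ℕ → Ω → Fin N × Fin M) : ℝ :=
  limsup (fun T : ℕ => (1 / (T : ℝ)) *
    ∑ t ∈ Finset.range T, ∑ n, ∫ ω, S.txPower H Γ t n ω ∂μ) atTop

/-- The time average of the throughput of link `n`, `liminf_T (1/T) ∑_{t ≤ T} E[R_n(t)]`. -/
def Network.avgRate (S : Network N M) (μ : Measure Ω) (Γ : ℕ → Ω → Fin N × Fin M)
    (n : Fin N) : ℝ :=
  liminf (fun T : ℕ => (1 / (T : ℝ)) *
    ∑ t ∈ Finset.range T, ∫ ω, S.service Γ t n ω ∂μ) atTop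

/-- The policy satisfies the throughput constraint. -/
def Network.MeetsThroughput (S : Network N M) (μ : Measure Ω) (Γ : ℕ → Ω → Fin N × Fin M) : Prop :=
  ∀ n, S.Rth ≤ S.avgRate μ Γ n

/-- `P*_id`: the optimum of the power minimization under the throughput constraint, over all
scheduling policies that know the instantaneous channel states of all links. -/
def Network.idealPower (S : Network N M) (μ : Measure Ω) (ℱ : Filtration ℕ mΩ)
    (H : ℕ → Ω → Fin N → ℂ) : ℝ :=
  sInf {p | ∃ Γ : ℕ → Ω → Fin N × Fin M,
    IsPolicy ℱ Γ ∧ S.MeetsThroughput μ Γ ∧ p = S.avgPower μ H Γ}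

/-- The time average of the total backlog, `limsup_T (1/T) ∑_{t ≤ T} ∑_n E[Q_n(t)]`, in `[0, ∞]`. -/
def Network.avgBacklog (S : Network N M) (μ : Measure Ω) (q₀ : Fin N → ℝ)
    (Γ : ℕ → Ω → Fin N × Fin M) : ℝ≥0∞ :=
  limsup (fun T : ℕ => (T : ℝ≥0∞)⁻¹ *
    ∑ t ∈ Finset.range T, ∑ n, ∫⁻ ω, ENNReal.ofReal (S.queue q₀ Γ t n ω) ∂μ) atTop

/-- Every virtual queue is strongly stable: `limsup_T (1/T) ∑_{t ≤ T} E[Q_n(t)] < ∞`. -/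
def Network.StronglyStable (S : Network N M) (μ : Measure Ω) (q₀ : Fin N → ℝ)
    (Γ : ℕ → Ω → Fin N × Fin M) : Prop :=
  ∀ n, limsup (fun T : ℕ => (T : ℝ≥0∞)⁻¹ *
    ∑ t ∈ Finset.range T, ∫⁻ ω, ENNReal.ofReal (S.queue q₀ Γ t n ω) ∂μ) atTop < ⊤

/-! ### Channel indexing feedback -/

/-- The energy metric `v_n = min_m (V P_{n,m} - Q_n R_m)` of a link with fading coefficient `h` and
backlog `q`. -/
def Network.metric (S : Network N M) (V : ℝ) (n : Fin N) (h : ℂ) (q : ℝ) : ℝ :=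
  ⨅ m, (V * S.power n m h - q * S.rate m)

/-- `v_min = - τ R_th R_M` in the slot with number `τ`. -/
def Network.vmin (S : Network N M) (τ : ℕ) : ℝ := -(τ * S.Rth * S.maxRate)

/-- `v_max = V P_max - R_th R_1` (the values `r = 1`, `f = 0` of the grid parameters, which are only
modified after a collision). -/
def Network.vmax (S : Network N M) (V : ℝ) : ℝ := V * S.Pmax - S.Rth * S.minRate

/-- The grid points `a_j`, `1 ≤ j ≤ K`, that divide `[v_min, v_max]` evenly. -/
def gridPoint (K : ℕ) (vmin vmax : ℝ) (j : ℕ) : ℝ :=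
  vmin + ((j : ℝ) - 1) * ((vmax - vmin) / ((K : ℝ) - 1))

/-- The index `j` of the closest grid point `a_j < v` below the metric `v` (and `1` if there is no
grid point below `v`): this is the resource element on which the CSI indicator is sent. -/
def csiIndex (K : ℕ) (vmin vmax v : ℝ) : ℕ :=
  open Classical in
  max 1 (((Finset.Icc 1 K).filter fun j => gridPoint K vmin vmax j < v).sup id)

/-- The resource element `k_n(t)` used by link `n` in slot `t` (whose number is `t + 1`), when there
are `K t ω` resource elements and the decisions so far were made by `Γ`. -/
def Network.resource (S : Network N M) (V : ℝ) (q₀ : Fin N → ℝ) (H : ℕ → Ω → Fin N → ℂ)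
    (K : ℕ → Ω → ℕ) (Γ : ℕ → Ω → Fin N × Fin M) (t : ℕ) (n : Fin N) (ω : Ω) : ℕ :=
  csiIndex (K t ω) (S.vmin (t + 1)) (S.vmax V) (S.metric V n (H t ω n) (S.queue q₀ Γ t n ω))

/-- No collision in slot `t`: no two links send their CSI indicators on the same resource element. -/
def Network.NoCollision (S : Network N M) (V : ℝ) (q₀ : Fin N → ℝ) (H : ℕ → Ω → Fin N → ℂ)
    (K : ℕ → Ω → ℕ) (Γ : ℕ → Ω → Fin N × Fin M) (t : ℕ) (ω : Ω) : Prop :=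
  ∀ n n', n ≠ n' → S.resource V q₀ H K Γ t n ω ≠ S.resource V q₀ H K Γ t n' ω

/-- Link `n` is the only one that sends on its resource element in slot `t`. -/
def Network.Exclusive (S : Network N M) (V : ℝ) (q₀ : Fin N → ℝ) (H : ℕ → Ω → Fin N → ℂ)
    (K : ℕ → Ω → ℕ) (Γ : ℕ → Ω → Fin N × Fin M) (t : ℕ) (n : Fin N) (ω : Ω) : Prop :=
  ∀ n', n' ≠ n → S.resource V q₀ H K Γ t n' ω ≠ S.resource V q₀ H K Γ t n ω

/-- `Γ` is the distributed scheduling: in each slot, the scheduled link is the one that sends its CSI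
indicator exclusively, on the resource element of lowest index, and its bit rate attains the minimum
in its energy metric. -/
def Network.IsDistributed (S : Network N M) (μ : Measure Ω) (V : ℝ) (q₀ : Fin N → ℝ)
    (H : ℕ → Ω → Fin N → ℂ) (K : ℕ → Ω → ℕ) (Γ : ℕ → Ω → Fin N × Fin M) : Prop :=
  ∀ t, ∀ᵐ ω ∂μ,
    S.Exclusive V q₀ H K Γ t (Γ t ω).1 ω ∧
    (∀ n, S.Exclusive V q₀ H K Γ t n ω →
      S.resource V q₀ H K Γ t (Γ t ω).1 ω ≤ S.resource V q₀ H K Γ t n ω) ∧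
    V * S.power (Γ t ω).1 (Γ t ω).2 (H t ω (Γ t ω).1)
        - S.queue q₀ Γ t (Γ t ω).1 ω * S.rate (Γ t ω).2 =
      S.metric V (Γ t ω).1 (H t ω (Γ t ω).1) (S.queue q₀ Γ t (Γ t ω).1 ω)

end Dynamics

end D2D

end

namespace D2D

variable {N M : ℕ}

/-! ### Elementary bounds and measurability -/

/-! The proof is a drift-plus-penalty argument. The grid index is monotone in the metric, so without
collisions the lowest index belongs to a link of least metric: the scheduling minimizes `score` over
all links and rates (`IsDistributed.ae_minScore_eq`). For the Lyapunov function `½ ∑ Q_n²`, the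
drift plus `V` times the power is at most `C + R_th ∑ Q_n + score` (`drift_add_penalty_le`). For
frozen backlogs `q`, the mean of the minimal score is at most the mean score of any policy in any
slot, hence at most `V P̄ - ∑ q_n R̄_n` after averaging over slots (`integral_minScore_le`); no
optimal stationary policy is needed. Since `Q(t)` is independent of `H(t)`, the random backlogs may
be substituted for `q`, and summing over slots telescopes to `sum_drift_add_penalty_le`. That one
inequality is used three times: for the power it gives the gap `C / V`; for the second moments of
the queues it gives `E[Q_n(T)] = O(√T)`, hence feasibility; for the backlog, with slack `ε`, it
gives stability. -/

lemma Network.power_nonneg (S : Network N M) (n : Fin N) (m : Fin M) (h : ℂ) :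
    0 ≤ S.power n m h := by
  have h1 := S.snr_pos m
  have h2 := S.noise_pos
  have h3 := S.pathLoss_pos n
  have h4 := S.Pmax_pos
  unfold Network.power
  split_ifs
  · exact h4.le
  · exact le_min (by positivity) h4.le

lemma Network.power_le (S : Network N M) (n : Fin N) (m : Fin M) (h : ℂ) :
    S.power n m h ≤ S.Pmax := by
  unfold Network.power
  split_ifs
  · exact le_rfl
  · exact min_le_right _ _

lemma Network.measurable_power (S : Network N M) (n : Fin N) (m : Fin M) :
    Measurable (S.power n m) := by
  classical
  have : S.power n m = fun h : ℂ => if h = 0 then S.Pmax else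
      min (S.snr m * S.noise / (‖h‖ ^ 2 * S.pathLoss n)) S.Pmax := by
    funext h
    unfold Network.power
    congr
  rw [this]
  exact Measurable.ite (measurableSet_singleton 0) measurable_const (by fun_prop)

lemma Network.rate_le_maxRate (S : Network N M) (m : Fin M) : S.rate m ≤ S.maxRate :=
  le_ciSup (Set.finite_range _).bddAbove m

lemma Network.maxRate_nonneg (S : Network N M) : 0 ≤ S.maxRate :=
  Real.iSup_nonneg S.rate_nonneg

/-- The energy metric of the link and rate index `x` for the backlogs `q` and the channel `h`. -/
noncomputable def Network.score (S : Network N M) (V : ℝ) (q : Fin N → ℝ) (h : Fin N → ℂ)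
    (x : Fin N × Fin M) : ℝ :=
  V * S.power x.1 x.2 (h x.1) - q x.1 * S.rate x.2

/-- The smallest energy metric over all links and rate indices. -/
noncomputable def Network.minScore (S : Network N M) (V : ℝ) (q : Fin N → ℝ) (h : Fin N → ℂ) : ℝ :=
  ⨅ x, S.score V q h x

lemma Network.minScore_le (S : Network N M) (V : ℝ) (q : Fin N → ℝ) (h : Fin N → ℂ)
    (x : Fin N × Fin M) : S.minScore V q h ≤ S.score V q h x :=
  ciInf_le (Set.finite_range _).bddBelow x

lemma Network.minScore_eq_of_forall_le (S : Network N M) {V : ℝ} {q : Fin N → ℝ} {h : Fin N → ℂ}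
    {x : Fin N × Fin M} (hx : ∀ y, S.score V q h x ≤ S.score V q h y) :
    S.minScore V q h = S.score V q h x :=
  have : Nonempty (Fin N × Fin M) := ⟨x⟩
  le_antisymm (S.minScore_le V q h x) (le_ciInf hx)

lemma Network.abs_score_le (S : Network N M) {V : ℝ} (hV : 0 < V) (q : Fin N → ℝ) (h : Fin N → ℂ)
    (x : Fin N × Fin M) : |S.score V q h x| ≤ V * S.Pmax + (∑ n, |q n|) * S.maxRate := by
  have h1 : |V * S.power x.1 x.2 (h x.1)| ≤ V * S.Pmax := by
    rw [abs_of_nonneg (mul_nonneg hV.le (S.power_nonneg _ _ _))]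
    exact mul_le_mul_of_nonneg_left (S.power_le _ _ _) hV.le
  have h2 : |q x.1 * S.rate x.2| ≤ (∑ n, |q n|) * S.maxRate := by
    rw [abs_mul, abs_of_nonneg (S.rate_nonneg _)]
    exact mul_le_mul (Finset.single_le_sum (f := fun n => |q n|) (fun _ _ => abs_nonneg _)
      (Finset.mem_univ x.1)) (S.rate_le_maxRate _) (S.rate_nonneg _)
      (Finset.sum_nonneg fun _ _ => abs_nonneg _)
  exact (abs_sub _ _).trans (add_le_add h1 h2)

lemma Network.abs_minScore_le (S : Network N M) [Nonempty (Fin N × Fin M)] {V : ℝ} (hV : 0 < V)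
    (q : Fin N → ℝ) (h : Fin N → ℂ) :
    |S.minScore V q h| ≤ V * S.Pmax + (∑ n, |q n|) * S.maxRate := by
  obtain ⟨x, hx⟩ := exists_eq_ciInf_of_finite (f := S.score V q h)
  rw [Network.minScore, ← hx]
  exact S.abs_score_le hV q h x

lemma Network.measurable_minScore (S : Network N M) (V : ℝ) {α : Type*} [MeasurableSpace α]
    {q : α → Fin N → ℝ} (hq : Measurable q) {h : α → Fin N → ℂ} (hh : Measurable h) :
    Measurable fun a => S.minScore V (q a) (h a) := by
  refine Measurable.iInf fun x => ?_
  have h1 : Measurable fun a => S.power x.1 x.2 (h a x.1) :=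
    (S.measurable_power x.1 x.2).comp ((measurable_pi_apply x.1).comp hh)
  have h2 : Measurable fun a => q a x.1 := (measurable_pi_apply x.1).comp hq
  exact (h1.const_mul V).sub (h2.mul_const _)

/-! ### Channel indexing without collisions -/

/-- Raising the metric only enlarges the set of grid points below it. Neither the number of grid
points nor the order of the endpoints matters; the scheduling argument only needs the links to share
one grid. -/
lemma csiIndex_mono (K : ℕ) (vmin vmax : ℝ) : Monotone (csiIndex K vmin vmax) := by
  classical
  intro v w hvw
  unfold csiIndex
  refine max_le_max le_rfl (Finset.sup_mono ?_)
  intro j hj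
  simp only [Finset.mem_filter] at hj ⊢
  exact ⟨hj.1, hj.2.trans_le hvw⟩

section Dynamics

variable {Ω : Type*} {mΩ : MeasurableSpace Ω}

/-- Without collisions, the distributed scheduling minimizes the energy metric over all links and
rate indices. -/
lemma Network.IsDistributed.ae_minScore_eq {S : Network N M} {μ : Measure Ω} {V : ℝ}
    {q₀ : Fin N → ℝ} {H : ℕ → Ω → Fin N → ℂ} {K : ℕ → Ω → ℕ} {Γ : ℕ → Ω → Fin N × Fin M}
    (hdist : S.IsDistributed μ V q₀ H K Γ)
    (hcol : ∀ t, ∀ᵐ ω ∂μ, S.NoCollision V q₀ H K Γ t ω) (t : ℕ) :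
    ∀ᵐ ω ∂μ, S.minScore V (fun n => S.queue q₀ Γ t n ω) (H t ω) =
      S.score V (fun n => S.queue q₀ Γ t n ω) (H t ω) (Γ t ω) := by
  filter_upwards [hdist t, hcol t] with ω hω hc
  obtain ⟨-, hmin, hrate⟩ := hω
  refine S.minScore_eq_of_forall_le fun y => ?_
  have hmetric : ∀ n m, S.metric V n (H t ω n) (S.queue q₀ Γ t n ω) ≤
      S.score V (fun n => S.queue q₀ Γ t n ω) (H t ω) (n, m) := fun n m =>
    ciInf_le (Set.finite_range _).bddBelow m
  refine hrate.le.trans (le_trans ?_ (hmetric y.1 y.2))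
  by_cases hy : y.1 = (Γ t ω).1
  · rw [hy]
  · by_contra! hlt
    -- A strictly smaller metric elsewhere would give an index no larger. Every link is exclusive,
    -- so the scheduled one also has the smallest index; the two indices would then coincide, which
    -- is a collision.
    refine hc _ _ hy (le_antisymm (csiIndex_mono _ _ _ hlt.le) ?_)
    exact hmin _ fun n' hn' => hc _ _ hn'

/-! ### Service rates and powers -/

lemma Network.service_nonneg (S : Network N M) (Γ : ℕ → Ω → Fin N × Fin M) (t : ℕ) (n : Fin N)
    (ω : Ω) : 0 ≤ S.service Γ t n ω := by
  unfold Network.service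
  split_ifs
  exacts [S.rate_nonneg _, le_rfl]

lemma Network.service_le (S : Network N M) (Γ : ℕ → Ω → Fin N × Fin M) (t : ℕ) (n : Fin N)
    (ω : Ω) : S.service Γ t n ω ≤ S.maxRate := by
  unfold Network.service
  split_ifs
  exacts [S.rate_le_maxRate _, S.maxRate_nonneg]

lemma Network.txPower_nonneg (S : Network N M) (H : ℕ → Ω → Fin N → ℂ)
    (Γ : ℕ → Ω → Fin N × Fin M) (t : ℕ) (n : Fin N) (ω : Ω) : 0 ≤ S.txPower H Γ t n ω := by
  unfold Network.txPower
  split_ifs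
  exacts [S.power_nonneg _ _ _, le_rfl]

lemma Network.txPower_le (S : Network N M) (H : ℕ → Ω → Fin N → ℂ)
    (Γ : ℕ → Ω → Fin N × Fin M) (t : ℕ) (n : Fin N) (ω : Ω) : S.txPower H Γ t n ω ≤ S.Pmax := by
  unfold Network.txPower
  split_ifs
  exacts [S.power_le _ _ _, S.Pmax_pos.le]

lemma Network.sum_service_sq_le (S : Network N M) (Γ : ℕ → Ω → Fin N × Fin M) (t : ℕ) (ω : Ω) :
    ∑ n, S.service Γ t n ω ^ 2 ≤ S.maxRate ^ 2 := by
  simp only [Network.service, ite_pow, ne_eq, OfNat.ofNat_ne_zero, not_false_eq_true, zero_pow,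
    Finset.sum_ite_eq, Finset.mem_univ, if_true]
  exact pow_le_pow_left₀ (S.rate_nonneg _) (S.rate_le_maxRate _) 2

/-- Only the scheduled link contributes to either sum. This identifies the minimized quantity with
the policy-dependent part of the drift-plus-penalty bound. -/
lemma Network.score_eq_sum (S : Network N M) (V : ℝ) (q : Fin N → ℝ) (H : ℕ → Ω → Fin N → ℂ)
    (Γ : ℕ → Ω → Fin N × Fin M) (t : ℕ) (ω : Ω) :
    S.score V q (H t ω) (Γ t ω) =
      V * ∑ n, S.txPower H Γ t n ω - ∑ n, q n * S.service Γ t n ω := by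
  simp [Network.score, Network.service, Network.txPower]

lemma IsPolicy.measurable_service {ℱ : Filtration ℕ mΩ} {Γ : ℕ → Ω → Fin N × Fin M}
    (hΓ : IsPolicy ℱ Γ) (S : Network N M) (t : ℕ) (n : Fin N) :
    Measurable[ℱ t] (S.service Γ t n) :=
  (measurable_of_countable fun x : Fin N × Fin M => if x.1 = n then S.rate x.2 else 0).comp (hΓ t)

lemma IsPolicy.measurable_txPower {ℱ : Filtration ℕ mΩ} {Γ : ℕ → Ω → Fin N × Fin M}
    (hΓ : IsPolicy ℱ Γ) (S : Network N M) {H : ℕ → Ω → Fin N → ℂ}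
    (hH : ∀ t, Measurable[ℱ t] (H t)) (t : ℕ) (n : Fin N) :
    Measurable[ℱ t] (S.txPower H Γ t n) := by
  have : Measurable fun p : (Fin N × Fin M) × (Fin N → ℂ) =>
      if p.1.1 = n then S.power n p.1.2 (p.2 n) else 0 := by
    refine measurable_from_prod_countable_right fun x => ?_
    by_cases hx : x.1 = n
    · simp only [hx, if_true]
      exact (S.measurable_power n x.2).comp (measurable_pi_apply n)
    · simp [hx]
  exact this.comp ((hΓ t).prodMk (hH t))

lemma integrable_of_measurable_of_abs_le {μ : Measure Ω} [IsFiniteMeasure μ] {f : Ω → ℝ}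
    (hf : Measurable f) (B : ℝ) (hB : ∀ ω, |f ω| ≤ B) : Integrable f μ :=
  Integrable.of_bound hf.aestronglyMeasurable B (ae_of_all _ hB)

lemma IsPolicy.integrable_service {μ : Measure Ω} [IsFiniteMeasure μ] {ℱ : Filtration ℕ mΩ}
    {Γ : ℕ → Ω → Fin N × Fin M} (hΓ : IsPolicy ℱ Γ) (S : Network N M) (t : ℕ) (n : Fin N) :
    Integrable (S.service Γ t n) μ :=
  integrable_of_measurable_of_abs_le ((hΓ.measurable_service S t n).mono (ℱ.le t) le_rfl) S.maxRate
    fun ω => (abs_of_nonneg (S.service_nonneg Γ t n ω)).trans_le (S.service_le Γ t n ω)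

lemma IsPolicy.integrable_txPower {μ : Measure Ω} [IsFiniteMeasure μ] {ℱ : Filtration ℕ mΩ}
    {Γ : ℕ → Ω → Fin N × Fin M} (hΓ : IsPolicy ℱ Γ) (S : Network N M) {H : ℕ → Ω → Fin N → ℂ}
    (hH : ∀ t, Measurable[ℱ t] (H t)) (t : ℕ) (n : Fin N) :
    Integrable (S.txPower H Γ t n) μ :=
  integrable_of_measurable_of_abs_le ((hΓ.measurable_txPower S hH t n).mono (ℱ.le t) le_rfl) S.Pmax
    fun ω => (abs_of_nonneg (S.txPower_nonneg H Γ t n ω)).trans_le (S.txPower_le H Γ t n ω)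

/-! ### Virtual queues -/

lemma Network.queue_nonneg (S : Network N M) {q₀ : Fin N → ℝ} (hq₀ : ∀ n, 0 ≤ q₀ n)
    (Γ : ℕ → Ω → Fin N × Fin M) (t : ℕ) (n : Fin N) (ω : Ω) : 0 ≤ S.queue q₀ Γ t n ω := by
  cases t with
  | zero => exact hq₀ n
  | succ t => exact add_nonneg (le_max_right _ _) S.Rth_nonneg

/-- Each slot adds at most `R_th`. This deterministic bound makes the queues and their squares
integrable. -/
lemma Network.queue_le (S : Network N M) {q₀ : Fin N → ℝ} (hq₀ : ∀ n, 0 ≤ q₀ n)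
    (Γ : ℕ → Ω → Fin N × Fin M) (t : ℕ) (n : Fin N) (ω : Ω) :
    S.queue q₀ Γ t n ω ≤ q₀ n + t * S.Rth := by
  induction t with
  | zero => simp [Network.queue]
  | succ t ih =>
    have h1 : max (S.queue q₀ Γ t n ω - S.service Γ t n ω) 0 ≤ q₀ n + t * S.Rth :=
      max_le (by linarith [S.service_nonneg Γ t n ω])
        ((S.queue_nonneg hq₀ Γ t n ω).trans ih)
    rw [Network.queue]
    push_cast
    linarith

lemma Network.le_queue_succ (S : Network N M) (q₀ : Fin N → ℝ) (Γ : ℕ → Ω → Fin N × Fin M)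
    (t : ℕ) (n : Fin N) (ω : Ω) :
    S.queue q₀ Γ t n ω - S.service Γ t n ω + S.Rth ≤ S.queue q₀ Γ (t + 1) n ω :=
  add_le_add_left (le_max_left _ _) _

/-- Expand `([Q - R]⁺ + R_th)²`, using `([Q - R]⁺)² ≤ (Q - R)²` and, in the cross term, `[Q - R]⁺ ≤
Q`. -/
lemma Network.queue_succ_sq_le (S : Network N M) {q₀ : Fin N → ℝ} (hq₀ : ∀ n, 0 ≤ q₀ n)
    (Γ : ℕ → Ω → Fin N × Fin M) (t : ℕ) (n : Fin N) (ω : Ω) :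
    S.queue q₀ Γ (t + 1) n ω ^ 2 ≤ S.queue q₀ Γ t n ω ^ 2 + S.service Γ t n ω ^ 2 + S.Rth ^ 2 +
      2 * S.queue q₀ Γ t n ω * (S.Rth - S.service Γ t n ω) := by
  have hq := S.queue_nonneg hq₀ Γ t n ω
  have hr := S.service_nonneg Γ t n ω
  have hR := S.Rth_nonneg
  rw [Network.queue]
  rcases le_total (S.queue q₀ Γ t n ω - S.service Γ t n ω) 0 with h | h
  · rw [max_eq_right h]
    nlinarith [sq_nonneg (S.queue q₀ Γ t n ω - S.service Γ t n ω), mul_nonneg hq hR]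
  · rw [max_eq_left h]
    nlinarith [mul_nonneg hr hR]

/-- The one-slot bound on the drift of the quadratic Lyapunov function, plus the power penalty. -/
lemma Network.drift_add_penalty_le (S : Network N M) (V : ℝ) {q₀ : Fin N → ℝ}
    (hq₀ : ∀ n, 0 ≤ q₀ n) (H : ℕ → Ω → Fin N → ℂ) (Γ : ℕ → Ω → Fin N × Fin M) (t : ℕ) (ω : Ω) :
    (∑ n, S.queue q₀ Γ (t + 1) n ω ^ 2) / 2 + V * ∑ n, S.txPower H Γ t n ω ≤
      (∑ n, S.queue q₀ Γ t n ω ^ 2) / 2 + S.C + S.Rth * ∑ n, S.queue q₀ Γ t n ω +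
        S.score V (fun n => S.queue q₀ Γ t n ω) (H t ω) (Γ t ω) := by
  have h1 := Finset.sum_le_sum fun n (_ : n ∈ Finset.univ) => S.queue_succ_sq_le hq₀ Γ t n ω
  have h2 := S.sum_service_sq_le Γ t ω
  have h3 : ∑ n, 2 * S.queue q₀ Γ t n ω * (S.Rth - S.service Γ t n ω) =
      2 * (S.Rth * ∑ n, S.queue q₀ Γ t n ω) -
        2 * ∑ n, S.queue q₀ Γ t n ω * S.service Γ t n ω := by
    rw [Finset.mul_sum, Finset.mul_sum, Finset.mul_sum, ← Finset.sum_sub_distrib]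
    exact Finset.sum_congr rfl fun n _ => by ring
  rw [Finset.sum_add_distrib, Finset.sum_add_distrib, Finset.sum_add_distrib, h3] at h1
  simp only [Finset.sum_const, Finset.card_univ, Fintype.card_fin, nsmul_eq_mul] at h1
  rw [S.score_eq_sum, Network.C]
  linarith

/-- The recursion uses decisions up to slot `t` only. This one-slot lag is what makes the backlog at
`t + 1` independent of `H (t + 1)`. -/
lemma IsPolicy.measurable_queue_succ {ℱ : Filtration ℕ mΩ} {Γ : ℕ → Ω → Fin N × Fin M}
    (hΓ : IsPolicy ℱ Γ) (S : Network N M) (q₀ : Fin N → ℝ) (t : ℕ) (n : Fin N) :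
    Measurable[ℱ t] (S.queue q₀ Γ (t + 1) n) := by
  induction t with
  | zero =>
    exact ((measurable_const.sub (hΓ.measurable_service S 0 n)).max measurable_const).add
      measurable_const
  | succ t ih =>
    exact (((ih.mono (ℱ.mono t.le_succ) le_rfl).sub (hΓ.measurable_service S (t + 1) n)).max
      measurable_const).add measurable_const

lemma IsPolicy.measurable_queue {ℱ : Filtration ℕ mΩ} {Γ : ℕ → Ω → Fin N × Fin M}
    (hΓ : IsPolicy ℱ Γ) (S : Network N M) (q₀ : Fin N → ℝ) (t : ℕ) (n : Fin N) :
    Measurable (S.queue q₀ Γ t n) := by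
  cases t with
  | zero => exact measurable_const
  | succ t => exact (hΓ.measurable_queue_succ S q₀ t n).mono (ℱ.le t) le_rfl

lemma IsPolicy.integrable_queue {μ : Measure Ω} [IsFiniteMeasure μ] {ℱ : Filtration ℕ mΩ}
    {Γ : ℕ → Ω → Fin N × Fin M} (hΓ : IsPolicy ℱ Γ) (S : Network N M) {q₀ : Fin N → ℝ}
    (hq₀ : ∀ n, 0 ≤ q₀ n) (t : ℕ) (n : Fin N) : Integrable (S.queue q₀ Γ t n) μ :=
  integrable_of_measurable_of_abs_le (hΓ.measurable_queue S q₀ t n) (q₀ n + t * S.Rth)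
    fun ω => (abs_of_nonneg (S.queue_nonneg hq₀ Γ t n ω)).trans_le (S.queue_le hq₀ Γ t n ω)

lemma IsPolicy.integrable_queue_sq {μ : Measure Ω} [IsFiniteMeasure μ] {ℱ : Filtration ℕ mΩ}
    {Γ : ℕ → Ω → Fin N × Fin M} (hΓ : IsPolicy ℱ Γ) (S : Network N M) {q₀ : Fin N → ℝ}
    (hq₀ : ∀ n, 0 ≤ q₀ n) (t : ℕ) (n : Fin N) :
    Integrable (fun ω => S.queue q₀ Γ t n ω ^ 2) μ :=
  integrable_of_measurable_of_abs_le ((hΓ.measurable_queue S q₀ t n).pow_const 2)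
    ((q₀ n + t * S.Rth) ^ 2) fun ω => by
      rw [abs_of_nonneg (sq_nonneg _)]
      exact pow_le_pow_left₀ (S.queue_nonneg hq₀ Γ t n ω) (S.queue_le hq₀ Γ t n ω) 2

/-- The backlogs at the beginning of a slot are independent of the channel in this slot. -/
lemma IsChannel.indepFun_queue {μ : Measure Ω} [IsProbabilityMeasure μ] {ℱ : Filtration ℕ mΩ}
    {H : ℕ → Ω → Fin N → ℂ} (hH : IsChannel μ ℱ H) {Γ : ℕ → Ω → Fin N × Fin M}
    (hΓ : IsPolicy ℱ Γ) (S : Network N M) (q₀ : Fin N → ℝ) (t : ℕ) :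
    IndepFun (fun ω n => S.queue q₀ Γ t n ω) (H t) μ := by
  cases t with
  -- `IsChannel` gives no independence for `H 0`; here it is the deterministic initial backlog that
  -- helps.
  | zero => exact indepFun_const_left (μ := μ) q₀ (H 0)
  | succ t =>
    have hm : Measurable[ℱ t] fun ω n => S.queue q₀ Γ (t + 1) n ω :=
      @measurable_pi_lambda _ _ _ (ℱ t) _ _ fun n => hΓ.measurable_queue_succ S q₀ t n
    exact indep_of_indep_of_le_left (hH.indep t).symm hm.comap_le

/-! ### Time averages -/

lemma one_div_mul_sum_range_nonneg {f : ℕ → ℝ} (h0 : ∀ t, 0 ≤ f t) (T : ℕ) :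
    0 ≤ (1 / (T : ℝ)) * ∑ t ∈ Finset.range T, f t :=
  mul_nonneg (by positivity) (Finset.sum_nonneg fun t _ => h0 t)

/-- The assumption `0 ≤ B` covers `T = 0`, where the average is `0` by convention. -/
lemma one_div_mul_sum_range_le {f : ℕ → ℝ} {B : ℝ} (hB0 : 0 ≤ B) (hB : ∀ t, f t ≤ B) (T : ℕ) :
    (1 / (T : ℝ)) * ∑ t ∈ Finset.range T, f t ≤ B := by
  rcases Nat.eq_zero_or_pos T with rfl | hT
  · simpa using hB0
  · have hT' : (0 : ℝ) < T := by exact_mod_cast hT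
    have h := Finset.sum_le_card_nsmul (Finset.range T) f B fun t _ => hB t
    rw [Finset.card_range, nsmul_eq_mul] at h
    rw [one_div, inv_mul_le_iff₀ hT']
    exact h

lemma le_one_div_mul_sum_range {f : ℕ → ℝ} {G : ℝ} (hG : ∀ t, G ≤ f t) {T : ℕ} (hT : 0 < T) :
    G ≤ (1 / (T : ℝ)) * ∑ t ∈ Finset.range T, f t := by
  have hT' : (0 : ℝ) < T := by exact_mod_cast hT
  have h := Finset.card_nsmul_le_sum (Finset.range T) f G fun t _ => hG t
  rw [Finset.card_range, nsmul_eq_mul] at h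
  rw [one_div, le_inv_mul_iff₀ hT']
  exact h

lemma Network.sum_integral_txPower_nonneg (S : Network N M) (μ : Measure Ω)
    (H : ℕ → Ω → Fin N → ℂ) (Γ : ℕ → Ω → Fin N × Fin M) (t : ℕ) :
    0 ≤ ∑ n, ∫ ω, S.txPower H Γ t n ω ∂μ :=
  Finset.sum_nonneg fun n _ => integral_nonneg fun ω => S.txPower_nonneg H Γ t n ω

/-- Real `limsup` and `liminf` can be compared only along bounded sequences; this and the similar
bounds below exclude their default values. -/
lemma Network.isBoundedUnder_ge_power (S : Network N M) (μ : Measure Ω) (H : ℕ → Ω → Fin N → ℂ)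
    (Γ : ℕ → Ω → Fin N × Fin M) :
    atTop.IsBoundedUnder (· ≥ ·) fun T : ℕ => (1 / (T : ℝ)) *
      ∑ t ∈ Finset.range T, ∑ n, ∫ ω, S.txPower H Γ t n ω ∂μ :=
  isBoundedUnder_of ⟨0, one_div_mul_sum_range_nonneg (S.sum_integral_txPower_nonneg μ H Γ)⟩

lemma Network.isBoundedUnder_ge_rate (S : Network N M) (μ : Measure Ω) (Γ : ℕ → Ω → Fin N × Fin M) (n : Fin N) :
    atTop.IsBoundedUnder (· ≥ ·) fun T : ℕ => (1 / (T : ℝ)) *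
      ∑ t ∈ Finset.range T, ∫ ω, S.service Γ t n ω ∂μ :=
  isBoundedUnder_of ⟨0, one_div_mul_sum_range_nonneg fun t =>
    integral_nonneg fun ω => S.service_nonneg Γ t n ω⟩

lemma IsChannel.measurable {μ : Measure Ω} {ℱ : Filtration ℕ mΩ}
    {H : ℕ → Ω → Fin N → ℂ} (hH : IsChannel μ ℱ H) (t : ℕ) : Measurable (H t) :=
  (hH.adapted t).mono (ℱ.le t) le_rfl

lemma integral_le_of_forall_le {μ : Measure Ω} [IsProbabilityMeasure μ] {f : Ω → ℝ} {B : ℝ}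
    (hf : Integrable f μ) (h : ∀ ω, f ω ≤ B) : ∫ ω, f ω ∂μ ≤ B := by
  simpa using integral_mono hf (integrable_const B) h

section Policy

variable {μ : Measure Ω} [IsProbabilityMeasure μ] {ℱ : Filtration ℕ mΩ}
  {H : ℕ → Ω → Fin N → ℂ} {Γ : ℕ → Ω → Fin N × Fin M}

lemma IsPolicy.sum_integral_txPower_le (hΓ : IsPolicy ℱ Γ) (S : Network N M)
    (hH : ∀ t, Measurable[ℱ t] (H t)) (t : ℕ) :
    ∑ n, ∫ ω, S.txPower H Γ t n ω ∂μ ≤ N * S.Pmax := by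
  have h := Finset.sum_le_card_nsmul Finset.univ (fun n => ∫ ω, S.txPower H Γ t n ω ∂μ) S.Pmax
    fun n _ => integral_le_of_forall_le (hΓ.integrable_txPower S hH t n) (S.txPower_le H Γ t n)
  simpa using h

lemma IsPolicy.isBoundedUnder_le_power (hΓ : IsPolicy ℱ Γ) (S : Network N M)
    (hH : ∀ t, Measurable[ℱ t] (H t)) :
    atTop.IsBoundedUnder (· ≤ ·) fun T : ℕ => (1 / (T : ℝ)) *
      ∑ t ∈ Finset.range T, ∑ n, ∫ ω, S.txPower H Γ t n ω ∂μ :=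
  isBoundedUnder_of ⟨N * S.Pmax, one_div_mul_sum_range_le
    (mul_nonneg N.cast_nonneg S.Pmax_pos.le) (hΓ.sum_integral_txPower_le S hH)⟩

lemma IsPolicy.avgPower_nonneg (hΓ : IsPolicy ℱ Γ) (S : Network N M)
    (hH : ∀ t, Measurable[ℱ t] (H t)) : 0 ≤ S.avgPower μ H Γ :=
  le_limsup_of_frequently_le (Frequently.of_forall
    (one_div_mul_sum_range_nonneg (S.sum_integral_txPower_nonneg μ H Γ)))
    (hΓ.isBoundedUnder_le_power S hH)

lemma IsPolicy.isBoundedUnder_le_rate (hΓ : IsPolicy ℱ Γ) (S : Network N M) (n : Fin N) :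
    atTop.IsBoundedUnder (· ≤ ·) fun T : ℕ => (1 / (T : ℝ)) *
      ∑ t ∈ Finset.range T, ∫ ω, S.service Γ t n ω ∂μ :=
  isBoundedUnder_of ⟨S.maxRate, one_div_mul_sum_range_le S.maxRate_nonneg fun t =>
    integral_le_of_forall_le (hΓ.integrable_service S t n) (S.service_le Γ t n)⟩

/-! ### Comparison with an arbitrary policy -/

lemma Network.integrable_minScore (S : Network N M) [Nonempty (Fin N × Fin M)] {V B : ℝ}
    (hV : 0 < V) {q : Ω → Fin N → ℝ} (hq : Measurable q) {h : Ω → Fin N → ℂ} (hh : Measurable h)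
    (hB : ∀ ω, ∑ n, |q ω n| ≤ B) : Integrable (fun ω => S.minScore V (q ω) (h ω)) μ := by
  have hm : Measurable fun ω => S.minScore V (q ω) (h ω) :=
    S.measurable_minScore V hq hh
  refine integrable_of_measurable_of_abs_le hm (V * S.Pmax + B * S.maxRate) fun ω => ?_
  have h1 := S.abs_minScore_le hV (q ω) (h ω)
  have h2 := mul_le_mul_of_nonneg_right (hB ω) S.maxRate_nonneg
  linarith

/-- For fixed backlogs, the expected minimal energy metric is at most the energy metric of any
policy in any slot. -/
lemma IsChannel.integral_minScore_le_slot (hH : IsChannel μ ℱ H) (hΓ : IsPolicy ℱ Γ)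
    (S : Network N M) {V : ℝ} (hV : 0 < V) (q : Fin N → ℝ) (s : ℕ) :
    ∫ h, S.minScore V q h ∂(μ.map (H 0)) ≤
      V * ∑ n, ∫ ω, S.txPower H Γ s n ω ∂μ - ∑ n, q n * ∫ ω, S.service Γ s n ω ∂μ := by
  obtain ⟨ω₀⟩ := nonempty_of_isProbabilityMeasure μ
  have : Nonempty (Fin N × Fin M) := ⟨Γ 0 ω₀⟩
  have hP := fun n => hΓ.integrable_txPower (μ := μ) S hH.adapted s n
  have hR := fun n => hΓ.integrable_service (μ := μ) S s n
  have hm : Measurable (S.minScore V q) := S.measurable_minScore V measurable_const measurable_id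
  have hP' : Integrable (fun ω => V * ∑ n, S.txPower H Γ s n ω) μ :=
    (integrable_finsetSum _ fun n _ => hP n).const_mul V
  have hR' : Integrable (fun ω => ∑ n, q n * S.service Γ s n ω) μ :=
    integrable_finsetSum _ fun n _ => (hR n).const_mul (q n)
  -- All slots have the same channel law, so the integral may be computed in slot `s`, where the
  -- policy acts.
  rw [← (hH.identDistrib s).map_eq, integral_map (hH.measurable s).aemeasurable
    hm.aestronglyMeasurable]
  have hφ : Integrable (fun ω => S.minScore V q (H s ω)) μ :=
    S.integrable_minScore (q := fun _ => q) (B := ∑ n, |q n|) hV measurable_const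
      (hH.measurable s) fun _ => le_rfl
  have hle : ∀ ω, S.minScore V q (H s ω) ≤
      V * ∑ n, S.txPower H Γ s n ω - ∑ n, q n * S.service Γ s n ω := fun ω =>
    (S.minScore_le V q (H s ω) (Γ s ω)).trans_eq (S.score_eq_sum V q H Γ s ω)
  calc ∫ ω, S.minScore V q (H s ω) ∂μ
      ≤ ∫ ω, (V * ∑ n, S.txPower H Γ s n ω - ∑ n, q n * S.service Γ s n ω) ∂μ :=
        integral_mono hφ (hP'.sub hR') hle
    _ = _ := by
        rw [integral_sub hP' hR', integral_const_mul, integral_finsetSum _ fun n _ => hP n,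
          integral_finsetSum _ fun n _ => (hR n).const_mul (q n)]
        simp only [integral_const_mul]

/-- The left side does not depend on the slot, so the slotwise bounds can be averaged over a horizon
`T` at which the average power is nearly below its limsup and all average rates are nearly above
their liminf. Nonnegative backlogs give the rate bounds the right sign. -/
lemma IsChannel.integral_minScore_le (hH : IsChannel μ ℱ H) (hΓ : IsPolicy ℱ Γ)
    (S : Network N M) {V : ℝ} (hV : 0 < V) {q : Fin N → ℝ} (hq : ∀ n, 0 ≤ q n) :
    ∫ h, S.minScore V q h ∂(μ.map (H 0)) ≤
      V * S.avgPower μ H Γ - ∑ n, q n * S.avgRate μ Γ n := by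
  have hB : 0 < V + ∑ n, q n := add_pos_of_pos_of_nonneg hV (Finset.sum_nonneg fun n _ => hq n)
  refine le_of_forall_pos_le_add fun η hη => ?_
  -- The power costs an error `V δ` and the rates cost `(∑ q_n) δ`; together they make up `η`.
  obtain ⟨δ, hδ, hδη⟩ : ∃ δ, 0 < δ ∧ δ * (V + ∑ n, q n) = η :=
    ⟨η / (V + ∑ n, q n), div_pos hη hB, div_mul_cancel₀ _ hB.ne'⟩
  have hp := eventually_lt_of_limsup_lt (lt_add_of_pos_right (S.avgPower μ H Γ) hδ)
    (hΓ.isBoundedUnder_le_power S hH.adapted)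
  have hr := eventually_all.2 fun n => eventually_lt_of_lt_liminf
    (sub_lt_self (S.avgRate μ Γ n) hδ) (S.isBoundedUnder_ge_rate μ Γ n)
  obtain ⟨T, hpT, hrT, hT⟩ := (hp.and (hr.and (eventually_gt_atTop 0))).exists
  have h1 := le_one_div_mul_sum_range
    (fun s => hH.integral_minScore_le_slot hΓ S hV q s) hT
  have h4 : ∑ t ∈ Finset.range T, ∑ n, q n * ∫ ω, S.service Γ t n ω ∂μ =
      ∑ n, q n * ∑ t ∈ Finset.range T, ∫ ω, S.service Γ t n ω ∂μ := by
    rw [Finset.sum_comm]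
    exact Finset.sum_congr rfl fun n _ => (Finset.mul_sum _ _ _).symm
  rw [Finset.sum_sub_distrib, ← Finset.mul_sum, h4, mul_sub,
    Finset.mul_sum (s := Finset.univ) (a := 1 / (T : ℝ))] at h1
  have h2 : ∑ n, q n * (S.avgRate μ Γ n - δ) ≤ ∑ n, 1 / (T : ℝ) *
      (q n * ∑ t ∈ Finset.range T, ∫ ω, S.service Γ t n ω ∂μ) :=
    Finset.sum_le_sum fun n _ => by
      rw [mul_left_comm]
      exact mul_le_mul_of_nonneg_left (hrT n).le (hq n)
  have h3 := mul_le_mul_of_nonneg_left hpT.le hV.le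
  simp only [mul_sub, Finset.sum_sub_distrib, ← Finset.sum_mul] at h2
  rw [mul_left_comm] at h3
  linarith

/-- As the backlogs are independent of the channel, the comparison with a policy `Γ'` carries over
to the random backlogs. -/
lemma IsChannel.integral_minScore_queue_le (hH : IsChannel μ ℱ H) (hΓ : IsPolicy ℱ Γ)
    {Γ' : ℕ → Ω → Fin N × Fin M} (hΓ' : IsPolicy ℱ Γ') (S : Network N M) {V : ℝ} (hV : 0 < V)
    {q₀ : Fin N → ℝ} (hq₀ : ∀ n, 0 ≤ q₀ n) (t : ℕ) :
    Integrable (fun ω => S.minScore V (fun n => S.queue q₀ Γ t n ω) (H t ω)) μ ∧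
    ∫ ω, S.minScore V (fun n => S.queue q₀ Γ t n ω) (H t ω) ∂μ ≤
      V * S.avgPower μ H Γ' - ∑ n, (∫ ω, S.queue q₀ Γ t n ω ∂μ) * S.avgRate μ Γ' n := by
  obtain ⟨ω₀⟩ := nonempty_of_isProbabilityMeasure μ
  have : Nonempty (Fin N × Fin M) := ⟨Γ 0 ω₀⟩
  set Q : Ω → Fin N → ℝ := fun ω n => S.queue q₀ Γ t n ω with hQ
  have hQm : Measurable Q := measurable_pi_lambda _ fun n => hΓ.measurable_queue S q₀ t n
  have hHm := hH.measurable t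
  have hY : Measurable fun ω => (Q ω, H t ω) := hQm.prodMk hHm
  have hFm : Measurable fun p : (Fin N → ℝ) × (Fin N → ℂ) => S.minScore V p.1 p.2 :=
    S.measurable_minScore V measurable_fst measurable_snd
  have hint : Integrable (fun ω => S.minScore V (Q ω) (H t ω)) μ :=
    S.integrable_minScore (B := ∑ n, (q₀ n + t * S.Rth)) hV hQm hHm fun ω =>
      Finset.sum_le_sum fun n _ => (abs_of_nonneg (S.queue_nonneg hq₀ Γ t n ω)).trans_le
        (S.queue_le hq₀ Γ t n ω)
  refine ⟨hint, ?_⟩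
  have : IsProbabilityMeasure (μ.map (H 0)) :=
    Measure.isProbabilityMeasure_map (hH.measurable 0).aemeasurable
  have : IsProbabilityMeasure (μ.map Q) := Measure.isProbabilityMeasure_map hQm.aemeasurable
  -- Independence makes the joint law a product, so by Fubini the channel can be averaged first with
  -- the backlogs frozen.
  have hmap : μ.map (fun ω => (Q ω, H t ω)) = (μ.map Q).prod (μ.map (H 0)) := by
    rw [(indepFun_iff_map_prod_eq_prod_map_map hQm.aemeasurable hHm.aemeasurable).1
      (hH.indepFun_queue hΓ S q₀ t), (hH.identDistrib t).map_eq]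
  have hint' : Integrable (fun p : (Fin N → ℝ) × (Fin N → ℂ) => S.minScore V p.1 p.2)
      ((μ.map Q).prod (μ.map (H 0))) := by
    rw [← hmap]
    exact (integrable_map_measure hFm.aestronglyMeasurable hY.aemeasurable).2 hint
  have hGint := hint'.integral_prod_left
  have hGint' : Integrable (fun ω => ∫ h, S.minScore V (Q ω) h ∂(μ.map (H 0))) μ :=
    (integrable_map_measure hGint.aestronglyMeasurable hQm.aemeasurable).1 hGint
  have hQi : ∀ n, Integrable (fun ω => Q ω n * S.avgRate μ Γ' n) μ := fun n =>
    (hΓ.integrable_queue S hq₀ t n).mul_const _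
  have hsum : Integrable (fun ω => ∑ n, Q ω n * S.avgRate μ Γ' n) μ :=
    integrable_finsetSum _ fun n _ => hQi n
  calc ∫ ω, S.minScore V (Q ω) (H t ω) ∂μ
      = ∫ p, S.minScore V p.1 p.2 ∂((μ.map Q).prod (μ.map (H 0))) := by
        rw [← hmap, integral_map hY.aemeasurable hFm.aestronglyMeasurable]
    _ = ∫ ω, ∫ h, S.minScore V (Q ω) h ∂(μ.map (H 0)) ∂μ := by
        rw [integral_prod _ hint', integral_map hQm.aemeasurable hGint.aestronglyMeasurable]
    _ ≤ ∫ ω, (V * S.avgPower μ H Γ' - ∑ n, Q ω n * S.avgRate μ Γ' n) ∂μ :=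
        integral_mono hGint' ((integrable_const _).sub hsum) fun ω =>
          hH.integral_minScore_le hΓ' S hV fun n => S.queue_nonneg hq₀ Γ t n ω
    _ = _ := by
        rw [integral_sub (integrable_const _) hsum, integral_finsetSum _ fun n _ => hQi n]
        simp [integral_mul_const, hQ]

/-- The drift-plus-penalty inequality, in expectation, for a policy that minimizes the energy metric
in every slot. -/
lemma IsChannel.integral_drift_add_penalty_le (hH : IsChannel μ ℱ H) (hΓ : IsPolicy ℱ Γ)
    {Γ' : ℕ → Ω → Fin N × Fin M} (hΓ' : IsPolicy ℱ Γ') (S : Network N M) {V : ℝ} (hV : 0 < V)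
    {q₀ : Fin N → ℝ} (hq₀ : ∀ n, 0 ≤ q₀ n)
    (hmin : ∀ t, ∀ᵐ ω ∂μ, S.minScore V (fun n => S.queue q₀ Γ t n ω) (H t ω) =
      S.score V (fun n => S.queue q₀ Γ t n ω) (H t ω) (Γ t ω)) (t : ℕ) :
    (∑ n, ∫ ω, S.queue q₀ Γ (t + 1) n ω ^ 2 ∂μ) / 2 + V * ∑ n, ∫ ω, S.txPower H Γ t n ω ∂μ +
        ∑ n, (S.avgRate μ Γ' n - S.Rth) * ∫ ω, S.queue q₀ Γ t n ω ∂μ ≤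
      (∑ n, ∫ ω, S.queue q₀ Γ t n ω ^ 2 ∂μ) / 2 + (S.C + V * S.avgPower μ H Γ') := by
  obtain ⟨hφ, hφle⟩ := hH.integral_minScore_queue_le hΓ hΓ' S hV hq₀ t
  have hP := fun n => hΓ.integrable_txPower (μ := μ) S hH.adapted t n
  have hQ := fun n => hΓ.integrable_queue (μ := μ) S hq₀ t n
  have hQ2 := fun t n => hΓ.integrable_queue_sq (μ := μ) S hq₀ t n
  have i1 : ∀ t, Integrable (fun ω => (∑ n, S.queue q₀ Γ t n ω ^ 2) / 2) μ := fun t =>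
    (integrable_finsetSum _ fun n _ => hQ2 t n).div_const 2
  have i2 : Integrable (fun ω => V * ∑ n, S.txPower H Γ t n ω) μ :=
    (integrable_finsetSum _ fun n _ => hP n).const_mul V
  have i3 : Integrable (fun ω => S.Rth * ∑ n, S.queue q₀ Γ t n ω) μ :=
    (integrable_finsetSum _ fun n _ => hQ n).const_mul _
  have i4 : Integrable (fun ω => (∑ n, S.queue q₀ Γ t n ω ^ 2) / 2 + S.C) μ :=
    (i1 t).add (integrable_const _)
  have key := integral_mono_ae ((i1 (t + 1)).add i2) ((i4.add i3).add hφ) (by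
    filter_upwards [hmin t] with ω hω
    have := S.drift_add_penalty_le V hq₀ H Γ t ω
    simp only [Pi.add_apply]
    rw [hω]
    exact this)
  rw [integral_add' (i1 (t + 1)) i2, integral_add' (i4.add i3) hφ, integral_add' i4 i3,
    integral_add (i1 t) (integrable_const _), integral_div, integral_div, integral_const_mul,
    integral_const_mul, integral_finsetSum _ fun n _ => hP n,
    integral_finsetSum _ fun n _ => hQ n, integral_finsetSum _ fun n _ => hQ2 t n,
    integral_finsetSum _ fun n _ => hQ2 (t + 1) n] at key
  simp only [integral_const, probReal_univ, one_smul] at key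
  have h4 : ∑ n, (S.avgRate μ Γ' n - S.Rth) * ∫ ω, S.queue q₀ Γ t n ω ∂μ =
      ∑ n, (∫ ω, S.queue q₀ Γ t n ω ∂μ) * S.avgRate μ Γ' n -
        S.Rth * ∑ n, ∫ ω, S.queue q₀ Γ t n ω ∂μ := by
    rw [Finset.mul_sum, ← Finset.sum_sub_distrib]
    exact Finset.sum_congr rfl fun n _ => by ring
  rw [h4]
  linarith

/-- The drift-plus-penalty inequality, summed over the first `T` slots. -/
lemma IsChannel.sum_drift_add_penalty_le (hH : IsChannel μ ℱ H) (hΓ : IsPolicy ℱ Γ)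
    {Γ' : ℕ → Ω → Fin N × Fin M} (hΓ' : IsPolicy ℱ Γ') (S : Network N M) {V : ℝ} (hV : 0 < V)
    {q₀ : Fin N → ℝ} (hq₀ : ∀ n, 0 ≤ q₀ n)
    (hmin : ∀ t, ∀ᵐ ω ∂μ, S.minScore V (fun n => S.queue q₀ Γ t n ω) (H t ω) =
      S.score V (fun n => S.queue q₀ Γ t n ω) (H t ω) (Γ t ω)) (T : ℕ) :
    (∑ n, ∫ ω, S.queue q₀ Γ T n ω ^ 2 ∂μ) / 2 +
        V * ∑ t ∈ Finset.range T, ∑ n, ∫ ω, S.txPower H Γ t n ω ∂μ +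
        ∑ t ∈ Finset.range T, ∑ n, (S.avgRate μ Γ' n - S.Rth) * ∫ ω, S.queue q₀ Γ t n ω ∂μ ≤
      (∑ n, q₀ n ^ 2) / 2 + T * (S.C + V * S.avgPower μ H Γ') := by
  induction T with
  | zero => simp [Network.queue]
  | succ T ih =>
    have h := hH.integral_drift_add_penalty_le hΓ hΓ' S hV hq₀ hmin T
    rw [Finset.sum_range_succ, Finset.sum_range_succ]
    push_cast
    linarith

end Policy

/-! ### Asymptotics -/

lemma tendsto_const_add_div_nat (A L : ℝ) :
    Tendsto (fun T : ℕ => A + L / (T : ℝ)) atTop (nhds A) := by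
  simpa using tendsto_const_nhds.add (tendsto_const_div_atTop_nhds_zero_nat L)

section Optimality

variable {μ : Measure Ω} [IsProbabilityMeasure μ] {ℱ : Filtration ℕ mΩ}
  {H : ℕ → Ω → Fin N → ℂ} {Γ Γ' : ℕ → Ω → Fin N × Fin M} {V : ℝ} {q₀ : Fin N → ℝ}

lemma Network.integral_queue_nonneg (S : Network N M) (μ : Measure Ω) (hq₀ : ∀ n, 0 ≤ q₀ n)
    (Γ : ℕ → Ω → Fin N × Fin M) (t : ℕ) (n : Fin N) : 0 ≤ ∫ ω, S.queue q₀ Γ t n ω ∂μ :=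
  integral_nonneg fun ω => S.queue_nonneg hq₀ Γ t n ω

lemma Network.sum_avgRate_sub_mul_nonneg (S : Network N M) (μ : Measure Ω) (hq₀ : ∀ n, 0 ≤ q₀ n)
    (hfeas : S.MeetsThroughput μ Γ') (T : ℕ) :
    0 ≤ ∑ t ∈ Finset.range T, ∑ n,
      (S.avgRate μ Γ' n - S.Rth) * ∫ ω, S.queue q₀ Γ t n ω ∂μ :=
  Finset.sum_nonneg fun t _ => Finset.sum_nonneg fun n _ =>
    mul_nonneg (sub_nonneg.2 (hfeas n)) (S.integral_queue_nonneg μ hq₀ Γ t n)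

lemma Network.sum_integral_queue_sq_nonneg (S : Network N M) (μ : Measure Ω)
    (Γ : ℕ → Ω → Fin N × Fin M) (t : ℕ) : 0 ≤ ∑ n, ∫ ω, S.queue q₀ Γ t n ω ^ 2 ∂μ :=
  Finset.sum_nonneg fun _ _ => integral_nonneg fun _ => sq_nonneg _

/-- A policy that minimizes the energy metric in every slot has at most the average power of any
feasible policy, up to `C / V`. -/
lemma IsChannel.avgPower_le (hH : IsChannel μ ℱ H) (hΓ : IsPolicy ℱ Γ) (hΓ' : IsPolicy ℱ Γ')
    (S : Network N M) (hV : 0 < V) (hq₀ : ∀ n, 0 ≤ q₀ n)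
    (hmin : ∀ t, ∀ᵐ ω ∂μ, S.minScore V (fun n => S.queue q₀ Γ t n ω) (H t ω) =
      S.score V (fun n => S.queue q₀ Γ t n ω) (H t ω) (Γ t ω))
    (hfeas : S.MeetsThroughput μ Γ') :
    S.avgPower μ H Γ ≤ S.avgPower μ H Γ' + S.C / V := by
  -- The initial Lyapunov value, divided by `V T`, is the only transient error.
  have hlim := tendsto_const_add_div_nat (S.avgPower μ H Γ' + S.C / V) ((∑ n, q₀ n ^ 2) / 2 / V)
  rw [← hlim.limsup_eq]
  refine limsup_le_limsup ?_ (S.isBoundedUnder_ge_power μ H Γ).isCoboundedUnder_le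
    hlim.isBoundedUnder_le
  filter_upwards [eventually_gt_atTop 0] with T hT
  have hT' : (0 : ℝ) < T := by exact_mod_cast hT
  have h1 := hH.sum_drift_add_penalty_le hΓ hΓ' S hV hq₀ hmin T
  have h2 := S.sum_avgRate_sub_mul_nonneg (Γ := Γ) μ hq₀ hfeas T
  have h3 := S.sum_integral_queue_sq_nonneg (q₀ := q₀) μ Γ T
  rw [one_div, inv_mul_le_iff₀ hT']
  refine le_of_mul_le_mul_left ?_ hV
  have h4 : V * (T * (S.avgPower μ H Γ' + S.C / V + (∑ n, q₀ n ^ 2) / 2 / V / T)) =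
      (∑ n, q₀ n ^ 2) / 2 + T * (S.C + V * S.avgPower μ H Γ') := by
    field_simp
    ring
  rw [h4]
  linarith

/-- Dropping the positive part and telescoping shows that a service deficit must accumulate in the
queue, so sublinear growth of the mean queue forces the throughput constraint. -/
lemma IsPolicy.integral_queue_le (hΓ : IsPolicy ℱ Γ) (S : Network N M) (hq₀ : ∀ n, 0 ≤ q₀ n)
    (n : Fin N) (T : ℕ) :
    q₀ n + T * S.Rth - ∑ t ∈ Finset.range T, ∫ ω, S.service Γ t n ω ∂μ ≤
      ∫ ω, S.queue q₀ Γ T n ω ∂μ := by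
  induction T with
  | zero => simp [Network.queue]
  | succ T ih =>
    have hQ := fun t => hΓ.integrable_queue (μ := μ) S hq₀ t n
    have hR := hΓ.integrable_service (μ := μ) S T n
    have h := integral_mono (((hQ T).sub hR).add (integrable_const S.Rth)) (hQ (T + 1))
      fun ω => S.le_queue_succ q₀ Γ T n ω
    rw [integral_add' ((hQ T).sub hR) (integrable_const _), integral_sub' (hQ T) hR] at h
    simp only [integral_const, probReal_univ, one_smul] at h
    rw [Finset.sum_range_succ]
    push_cast
    linarith

/-- A policy that minimizes the energy metric in every slot is feasible as soon as a feasible policy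
exists: its virtual queues grow at most like the square root of time. -/
lemma IsChannel.meetsThroughput (hH : IsChannel μ ℱ H) (hΓ : IsPolicy ℱ Γ) (hΓ' : IsPolicy ℱ Γ')
    (S : Network N M) (hV : 0 < V) (hq₀ : ∀ n, 0 ≤ q₀ n)
    (hmin : ∀ t, ∀ᵐ ω ∂μ, S.minScore V (fun n => S.queue q₀ Γ t n ω) (H t ω) =
      S.score V (fun n => S.queue q₀ Γ t n ω) (H t ω) (Γ t ω))
    (hfeas : S.MeetsThroughput μ Γ') : S.MeetsThroughput μ Γ := by
  intro n
  set A := S.C + V * S.avgPower μ H Γ' with hA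
  set L := ∑ n, q₀ n ^ 2 with hL
  have hlim : Tendsto (fun T : ℕ => S.Rth - (1 + 2 * A + L / (T : ℝ)) * (√(T : ℝ))⁻¹) atTop
      (nhds S.Rth) := by
    have hs : Tendsto (fun T : ℕ => (√(T : ℝ))⁻¹) atTop (nhds 0) :=
      (Real.tendsto_sqrt_atTop.comp tendsto_natCast_atTop_atTop).inv_tendsto_atTop
    simpa using (tendsto_const_nhds (x := S.Rth)).sub
      ((tendsto_const_add_div_nat (1 + 2 * A) L).mul hs)
  rw [← hlim.liminf_eq]
  refine liminf_le_liminf ?_ hlim.isBoundedUnder_ge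
    (hΓ.isBoundedUnder_le_rate S n).isCoboundedUnder_ge
  filter_upwards [eventually_gt_atTop 0] with T hT
  have hT' : (0 : ℝ) < T := by exact_mod_cast hT
  have hsq : 0 < √(T : ℝ) := Real.sqrt_pos.2 hT'
  have hss : √(T : ℝ) * √(T : ℝ) = T := Real.mul_self_sqrt hT'.le
  have h1 := hH.sum_drift_add_penalty_le hΓ hΓ' S hV hq₀ hmin T
  have h2 := S.sum_avgRate_sub_mul_nonneg (Γ := Γ) μ hq₀ hfeas T
  have h3 := mul_nonneg hV.le (Finset.sum_nonneg (s := Finset.range T)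
    fun t _ => S.sum_integral_txPower_nonneg μ H Γ t)
  have h4 : ∫ ω, S.queue q₀ Γ T n ω ^ 2 ∂μ ≤ ∑ n, ∫ ω, S.queue q₀ Γ T n ω ^ 2 ∂μ :=
    Finset.single_le_sum (f := fun n => ∫ ω, S.queue q₀ Γ T n ω ^ 2 ∂μ)
      (fun n _ => integral_nonneg fun ω => sq_nonneg _) (Finset.mem_univ n)
  have h5 : ∫ ω, S.queue q₀ Γ T n ω ^ 2 ∂μ ≤ L + T * (2 * A) := by linarith
  have hQ2 := hΓ.integrable_queue_sq (μ := μ) S hq₀ T n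
  -- From `2 √T Q ≤ T + Q²`: the linear bound on the second moment becomes a `√T` bound on the mean.
  have h6 : √(T : ℝ) * ∫ ω, S.queue q₀ Γ T n ω ∂μ ≤ T + ∫ ω, S.queue q₀ Γ T n ω ^ 2 ∂μ := by
    have h := integral_mono (μ := μ) ((hΓ.integrable_queue S hq₀ T n).const_mul √(T : ℝ))
      ((integrable_const (T : ℝ)).add hQ2) fun ω => by
        have := two_mul_le_add_sq √(T : ℝ) (S.queue q₀ Γ T n ω)
        have := mul_nonneg hsq.le (S.queue_nonneg hq₀ Γ T n ω)
        simp only [Pi.add_apply]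
        nlinarith
    rw [integral_add' (integrable_const _) hQ2, integral_const_mul] at h
    simpa using h
  have h7 := hΓ.integral_queue_le (μ := μ) S hq₀ n T
  have h8 : ∫ ω, S.queue q₀ Γ T n ω ∂μ ≤ T * ((1 + 2 * A + L / T) * (√(T : ℝ))⁻¹) := by
    have : (T : ℝ) * ((1 + 2 * A + L / T) * (√(T : ℝ))⁻¹) =
        (T + (L + T * (2 * A))) / √(T : ℝ) := by
      field_simp
      ring
    rw [this, le_div_iff₀ hsq, mul_comm]
    linarith
  rw [one_div, le_inv_mul_iff₀ hT', mul_sub]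
  linarith [hq₀ n]

/-- The bound on the average backlog of a policy that minimizes the energy metric in every slot. -/
lemma IsChannel.avgBacklog_le (hH : IsChannel μ ℱ H) (hΓ : IsPolicy ℱ Γ) (hΓ' : IsPolicy ℱ Γ')
    (S : Network N M) (hV : 0 < V) (hq₀ : ∀ n, 0 ≤ q₀ n)
    (hmin : ∀ t, ∀ᵐ ω ∂μ, S.minScore V (fun n => S.queue q₀ Γ t n ω) (H t ω) =
      S.score V (fun n => S.queue q₀ Γ t n ω) (H t ω) (Γ t ω))
    {ε : ℝ} (hε : 0 < ε) (hslack : ∀ n, S.Rth + ε ≤ S.avgRate μ Γ' n) :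
    S.avgBacklog μ q₀ Γ ≤ ENNReal.ofReal ((S.C + V * S.avgPower μ H Γ') / ε) := by
  set A := S.C + V * S.avgPower μ H Γ' with hA
  set L := (∑ n, q₀ n ^ 2) / 2 with hL
  have hlim := ENNReal.tendsto_ofReal (tendsto_const_add_div_nat (A / ε) (L / ε))
  rw [← hlim.limsup_eq]
  refine limsup_le_limsup ?_
  filter_upwards [eventually_gt_atTop 0] with T hT
  have hT' : (0 : ℝ) < T := by exact_mod_cast hT
  have hQ0 := S.integral_queue_nonneg μ hq₀ Γ
  have hcast : ∑ t ∈ Finset.range T, ∑ n, ∫⁻ ω, ENNReal.ofReal (S.queue q₀ Γ t n ω) ∂μ =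
      ENNReal.ofReal (∑ t ∈ Finset.range T, ∑ n, ∫ ω, S.queue q₀ Γ t n ω ∂μ) := by
    rw [ENNReal.ofReal_sum_of_nonneg fun t _ => Finset.sum_nonneg fun n _ => hQ0 t n]
    refine Finset.sum_congr rfl fun t _ => ?_
    rw [ENNReal.ofReal_sum_of_nonneg fun n _ => hQ0 t n]
    refine Finset.sum_congr rfl fun n _ => ?_
    exact (ofReal_integral_eq_lintegral_ofReal (hΓ.integrable_queue S hq₀ t n)
      (ae_of_all _ (S.queue_nonneg hq₀ Γ t n))).symm
  rw [hcast, ← ENNReal.ofReal_natCast, ← ENNReal.ofReal_inv_of_pos hT',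
    ← ENNReal.ofReal_mul (inv_nonneg.2 hT'.le)]
  refine ENNReal.ofReal_le_ofReal ?_
  have h1 := hH.sum_drift_add_penalty_le hΓ hΓ' S hV hq₀ hmin T
  have h2 := mul_nonneg hV.le (Finset.sum_nonneg (s := Finset.range T)
    fun t _ => S.sum_integral_txPower_nonneg μ H Γ t)
  have h3 := S.sum_integral_queue_sq_nonneg (q₀ := q₀) μ Γ T
  -- The slack makes each coefficient `R̄_n - R_th` at least `ε`, so the third sum in the telescoped
  -- inequality controls the backlog.
  have h4 : ε * ∑ t ∈ Finset.range T, ∑ n, ∫ ω, S.queue q₀ Γ t n ω ∂μ ≤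
      ∑ t ∈ Finset.range T, ∑ n,
        (S.avgRate μ Γ' n - S.Rth) * ∫ ω, S.queue q₀ Γ t n ω ∂μ := by
    simp only [Finset.mul_sum]
    exact Finset.sum_le_sum fun t _ => Finset.sum_le_sum fun n _ =>
      mul_le_mul_of_nonneg_right (by linarith [hslack n]) (hQ0 t n)
  rw [inv_mul_le_iff₀ hT']
  refine le_of_mul_le_mul_left ?_ hε
  have h5 : ε * (T * (A / ε + L / ε / T)) = L + T * A := by
    field_simp
    ring
  rw [h5]
  linarith

end Optimality

/-- Each queue is one nonnegative term of the total backlog. -/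
lemma Network.stronglyStable_of_avgBacklog_lt_top (S : Network N M) {μ : Measure Ω}
    {q₀ : Fin N → ℝ} {Γ : ℕ → Ω → Fin N × Fin M} (h : S.avgBacklog μ q₀ Γ < ⊤) :
    S.StronglyStable μ q₀ Γ := by
  intro n
  refine lt_of_le_of_lt (limsup_le_limsup (Eventually.of_forall fun T => ?_)) h
  refine mul_le_mul_right (Finset.sum_le_sum fun t _ => ?_) _
  exact Finset.single_le_sum (f := fun n => ∫⁻ ω, ENNReal.ofReal (S.queue q₀ Γ t n ω) ∂μ)
    (fun _ _ => zero_le) (Finset.mem_univ n)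

end Dynamics

end D2D

theorem mainTheorem1 {N M : ℕ} (S : D2D.Network N M)
    {Ω : Type*} {mΩ : MeasurableSpace Ω} (μ : Measure Ω) [IsProbabilityMeasure μ]
    (ℱ : Filtration ℕ mΩ) (H : ℕ → Ω → Fin N → ℂ) (hH : D2D.IsChannel μ ℱ H)
    (hfeas : ∃ Γ : ℕ → Ω → Fin N × Fin M, D2D.IsPolicy ℱ Γ ∧ S.MeetsThroughput μ Γ)
    (V : ℝ) (hV : 0 < V) (q₀ : Fin N → ℝ) (hq₀ : ∀ n, 0 ≤ q₀ n) (K : ℕ → Ω → ℕ)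
    (Γdist : ℕ → Ω → Fin N × Fin M) (hΓ : D2D.IsPolicy ℱ Γdist)
    (hdist : S.IsDistributed μ V q₀ H K Γdist)
    (hcol : ∀ t, ∀ᵐ ω ∂μ, S.NoCollision V q₀ H K Γdist t ω) :
    S.MeetsThroughput μ Γdist ∧
    S.idealPower μ ℱ H ≤ S.avgPower μ H Γdist ∧
    S.avgPower μ H Γdist ≤ S.idealPower μ ℱ H + S.C / V ∧
    ∀ ε : ℝ, 0 < ε → ∀ Γ : ℕ → Ω → Fin N × Fin M, D2D.IsPolicy ℱ Γ →
      (∀ n, S.Rth + ε ≤ S.avgRate μ Γ n) →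
      S.StronglyStable μ q₀ Γdist ∧
      S.avgBacklog μ q₀ Γdist ≤ ENNReal.ofReal ((S.C + V * S.avgPower μ H Γ) / ε) := by
  have hmin := hdist.ae_minScore_eq hcol
  obtain ⟨Γ₀, hΓ₀, hfeas₀⟩ := hfeas
  have hmeets := hH.meetsThroughput hΓ hΓ₀ S hV hq₀ hmin hfeas₀
  refine ⟨hmeets, ?_, ?_, ?_⟩
  -- `Γdist` is itself a feasible competitor, and `0` bounds all average powers from below.
  · refine csInf_le ⟨0, ?_⟩ ⟨Γdist, hΓ, hmeets, rfl⟩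
    rintro p ⟨Γ, hΓp, -, rfl⟩
    exact hΓp.avgPower_nonneg S hH.adapted
  · rw [← sub_le_iff_le_add]
    -- The given feasible policy makes the set nonempty; otherwise `sInf` would take its default
    -- value `0`.
    refine le_csInf ⟨_, Γ₀, hΓ₀, hfeas₀, rfl⟩ ?_
    rintro p ⟨Γ, hΓp, hfeasΓ, rfl⟩
    rw [sub_le_iff_le_add]
    exact hH.avgPower_le hΓ hΓp S hV hq₀ hmin hfeasΓ
  · intro ε hε Γ hΓp hslack
    have hback := hH.avgBacklog_le hΓ hΓp S hV hq₀ hmin hε hslack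
    exact ⟨S.stronglyStable_of_avgBacklog_lt_top (hback.trans_lt ENNReal.ofReal_lt_top), hback⟩
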